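/- Let $q$ be a prime, $\mathbb{Z}_q=\{0,\dots,q-1\}$ the field with $q$ elements, and $\mathbb{Z}_q((t^{-1}))$ the field of formal Laurent series $g=\sum_{i\ge w} g_i t^{-i}$ with $w\in\mathbb{Z}$, $g_i\in\mathbb{Z}_q$. The fractional part of $g$ is $\{g\}=\sum_{i\ge \max(1,w)} g_i t^{-i}$; let $\overline{\mathbb{Z}}_q((t^{-1}))$ be the compact additive group of all fractional parts (with the $t^{-1}$-adic topology), $\mu$ its normalized Haar measure, $\mu_d$ the $d$-fold product measure on $(\overline{\mathbb{Z}}_q((t^{-1})))^d$, and $\phi\big(\sum_{i\ge1} g_i t^{-i}\big)=\sum_{i\ge 1} g_i q^{-i}\in[0,1]$. For $\boldsymbol f=(f_1,\dots,f_d)\in(\overline{\mathbb{Z}}_q((t^{-1})))^d$ let $\mathcal{P}_N(\boldsymbol f)=\{\boldsymbol x_1,\dots,\boldsymbol x_N\}$ (points counted with multiplicity), where $\boldsymbol x_n=\big(\phi(\{t^{n-1}f_1\}),\dots,\phi(\{t^{n-1}f_d\})\big)$. The star discrepancy is $$D_N^*(\mathcal{P}_N)=\sup_{\boldsymbol t\in[0,1]^d}\left|\frac{\#\{1\le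 n\le N:\boldsymbol x_n\in\prod_{j=1}^d[0,t_j)\}}{N}-\lambda\Big(\prod_{j=1}^d[0,t_j)\Big)\right|,$$ with $\lambda$ the Lebesgue measure. Then for every prime $q$ and every $\delta\in(0,1)$ there is a constant $C(q,\delta)>0$, depending only on $q$ and $\delta$, such that for every integer $d\ge2$ $$\mu_d\left(\Big\{\boldsymbol f:\ D_N^*(\mathcal{P}_N(\boldsymbol f))\le C(q,\delta)\,(\log N)\sqrt{\frac{d\log d}{N}}\ \text{ for all } N\ge2\Big\}\right)\ge 1-\delta .$$ -/

import Mathlib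

open MeasureTheory TopologicalSpace
open scoped LaurentSeries WithZero

/-- The field of formal Laurent series over `ℤ_q` in the variable `t⁻¹`: the coefficient at the
index `i : ℤ` is the coefficient of `t⁻ⁱ`. It carries Mathlib's `t⁻¹`-adic topology. -/
abbrev LaurentInv (q : ℕ) [Fact q.Prime] : Type := (ZMod q)⸨X⸩

/-- The element `t` of the field of formal Laurent series in the variable `t⁻¹`. -/
noncomputable def tVar (q : ℕ) [Fact q.Prime] : LaurentInv q := HahnSeries.single (-1 : ℤ) 1

/-- The additive group of the Laurent series `∑_{i ≥ 1} g_i t⁻ⁱ`, i.e. of all fractional parts.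
It carries the subspace topology. -/
def FracGroup (q : ℕ) [Fact q.Prime] : AddSubgroup (LaurentInv q) where
  carrier := {g | ∀ i : ℤ, i ≤ 0 → g.coeff i = 0}
  zero_mem' := fun i _ => by simp
  add_mem' := fun {a b} ha hb i hi => by simp [ha i hi, hb i hi]
  neg_mem' := fun {a} ha i hi => by simp [ha i hi]

/-- The fractional part `{g} = ∑_{i ≥ max(1,w)} g_i t⁻ⁱ` of `g = ∑_{i ≥ w} g_i t⁻ⁱ`. -/
noncomputable def fracPart {q : ℕ} [Fact q.Prime] (g : LaurentInv q) : FracGroup q :=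
  ⟨{ coeff := fun i => if 1 ≤ i then g.coeff i else 0
     isPWO_support' := g.isPWO_support.mono fun i hi => by
      by_cases h : 1 ≤ i
      · simpa [h] using hi
      · simp [h] at hi },
    fun i hi => if_neg (by lia)⟩

/-- The map `φ : ∑_{i ≥ 1} g_i t⁻ⁱ ↦ ∑_{i ≥ 1} g_i q⁻ⁱ`, digits being read in `{0, …, q - 1}`. -/
noncomputable def phi {q : ℕ} [Fact q.Prime] (g : FracGroup q) : ℝ :=
  ∑' i : ℕ, ((g.1.coeff ((i : ℤ) + 1)).val : ℝ) * ((q : ℝ)⁻¹) ^ (i + 1)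

/-- The Laurent series `∑_{i ≥ 1} a_{i-1} t⁻ⁱ`. -/
noncomputable def ofDigits {q : ℕ} [Fact q.Prime] (a : ℕ → ZMod q) : LaurentInv q :=
  HahnSeries.single (1 : ℤ) 1 * (PowerSeries.mk a : (ZMod q)⸨X⸩)

theorem coeff_ofDigits {q : ℕ} [Fact q.Prime] (a : ℕ → ZMod q) (i : ℤ) :
    (ofDigits a).coeff i = if 1 ≤ i then a (i - 1).toNat else 0 := by
  have h := HahnSeries.coeff_single_mul_add (r := (1 : ZMod q))
    (x := ((PowerSeries.mk a : PowerSeries (ZMod q)) : (ZMod q)⸨X⸩)) (a := i - 1) (b := (1 : ℤ))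
  rw [sub_add_cancel, one_mul, PowerSeries.coeff_coe] at h
  rw [ofDigits, h]
  by_cases hi : 1 ≤ i
  · rw [if_neg (by lia), if_pos hi, PowerSeries.coeff_mk]
    congr 1
    lia
  · rw [if_pos (by lia), if_neg hi]

theorem range_ofDigits (q : ℕ) [Fact q.Prime] :
    Set.range (ofDigits (q := q)) = (FracGroup q : Set (LaurentInv q)) := by
  ext g
  constructor
  · rintro ⟨a, rfl⟩ i hi
    rw [coeff_ofDigits, if_neg (by lia)]
  · intro hg
    refine ⟨fun n => g.coeff ((n : ℤ) + 1), ?_⟩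
    ext i
    rw [coeff_ofDigits]
    split_ifs with hi
    · congr 1
      lia
    · exact (hg i (by lia)).symm

theorem continuous_ofDigits (q : ℕ) [Fact q.Prime] : Continuous (ofDigits (q := q)) := by
  rw [continuous_iff_continuousAt]
  intro a
  rw [ContinuousAt, Filter.tendsto_def]
  intro s hs
  obtain ⟨γ, hγ⟩ := Valued.mem_nhds.mp hs
  set r : ℤᵐ⁰ := MonoidWithZeroHom.ValueGroup₀.embedding γ.1 with hr
  have hr0 : r ≠ 0 := by simp [hr]
  have key : ∀ᶠ b in nhds a, ∀ n ∈ Finset.range (1 - WithZero.log r).toNat, b n = a n := by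
    rw [Filter.eventually_all_finset]
    intro n _
    have ht : Filter.Tendsto (fun b : ℕ → ZMod q => b n) (nhds a) (nhds (a n)) :=
      (continuous_apply n).tendsto a
    rw [nhds_discrete (ZMod q)] at ht
    exact ht.eventually (p := fun y => y = a n) (Filter.eventually_pure.mpr rfl)
  filter_upwards [key] with b hb
  refine hγ ?_
  rw [Set.mem_ofPred_eq, Valuation.restrict_lt_iff_lt_embedding]
  refine lt_of_le_of_lt (b := WithZero.exp (-(1 - WithZero.log r))) ?_ ?_
  · rw [LaurentSeries.valuation_le_iff_coeff_lt_eq_zero]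
    intro n hn
    rw [HahnSeries.coeff_sub, coeff_ofDigits, coeff_ofDigits]
    split_ifs with h1
    · rw [hb _ (Finset.mem_range.mpr (by lia)), sub_self]
    · exact sub_self _
  · change _ < r
    rw [← WithZero.lt_log_iff_exp_lt hr0]
    lia

instance instCompactSpaceFracGroup (q : ℕ) [Fact q.Prime] : CompactSpace (FracGroup q) := by
  refine isCompact_iff_compactSpace.mp (?_ : IsCompact (FracGroup q : Set (LaurentInv q)))
  rw [← range_ofDigits]
  exact isCompact_range (continuous_ofDigits q)

/-- The Borel `σ`-algebra. -/
noncomputable instance instMeasurableSpaceFracGroup (q : ℕ) [Fact q.Prime] : MeasurableSpace (FracGroup q) :=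
  borel (FracGroup q)

instance instBorelSpaceFracGroup (q : ℕ) [Fact q.Prime] : BorelSpace (FracGroup q) := ⟨rfl⟩

/-- The Haar measure on the compact group `FracGroup q`, normalized to total mass one. -/
noncomputable def normHaar (q : ℕ) [Fact q.Prime] : Measure (FracGroup q) :=
  Measure.addHaarMeasure (⊤ : PositiveCompacts (FracGroup q))

/-- The `d`-fold product of the normalized Haar measure. -/
noncomputable def normHaarPi (q : ℕ) [Fact q.Prime] (d : ℕ) : Measure (Fin d → FracGroup q) :=
  Measure.pi fun _ => normHaar q

/-- The star discrepancy of `N` points in dimension `d` (counted with multiplicity): the supremum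
over `t ∈ [0,1]^d` of `|A([0,t), P) / N - λ([0,t))|`. -/
noncomputable def starDiscrepancy {d N : ℕ} (P : Fin N → Fin d → ℝ) : ℝ :=
  ⨆ t : Set.Icc (0 : Fin d → ℝ) 1,
    |(Nat.card {n : Fin N // P n ∈ Set.univ.pi fun j => Set.Ico 0 (t.1 j)} : ℝ) / N
      - (volume (Set.univ.pi fun j => Set.Ico 0 (t.1 j))).toReal|

/-- The points `x_1, …, x_N` with `x_n = φ({t^{n-1} f})`, componentwise; the index `n : Fin N`
starts at `0` and stands for the point `x_{n+1}`. -/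
noncomputable def kroneckerPoints {q : ℕ} [Fact q.Prime] {d : ℕ} (f : Fin d → FracGroup q) (N : ℕ) :
    Fin N → Fin d → ℝ :=
  fun n j => phi (fracPart (tVar q ^ (n : ℕ) * (f j : LaurentInv q)))

/-!
The points of the sequence are read off from `d` sequences of `q`-ary digits: the `j`-th coordinate
of `x_{n+1}` has the digits of `f_j` from position `n` on. Under normalized Haar measure these
digits are independent and uniform, because the law of independent uniform digits is translation
invariant on `FracGroup q` and Haar probability measures are unique (`normHaar_eq_map`,
`normHaarPi_eq_map`). It remains to study independent digits.

Take `L = ⌈log_q N⌉` and keep only the first `L` digits of every coordinate. This moves points inside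
cells of a grid of mesh `q ^ (-L) ≤ 1 / N`, so the star discrepancy is determined, up to `d / N`, by
the numbers of points in the at most `(q N) ^ d` boxes with corners on the grid
(`starDiscrepancy_le_of_grid`). Whether the truncated point of index `n` is in a given box depends
only on the digits at the positions in `[n, n + L)`, so the points whose indices lie in one residue
class modulo `L` are independent, and Hoeffding's inequality for each of the `L` classes gives a
deviation of at least `ε` in the count with probability at most `2 exp (-ε² / (L N))`
(`measure_abs_sum_sub_ge_le_of_residue_indep`).

For `ε = N B / 2`, where `B = C log N √(d log d / N)`, the exponent is of order `C² d log d log N`,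
since `L` is of order `log N`. It beats the entropy `d log (q N)` of the grid, and a large `C` makes
the probabilities of the bad events summable over `N ≥ 2` with sum at most `δ`, uniformly in `d`
(`grid_card_mul_exp_le`, `exists_pow_exponent`). This is used for `N ≥ d`, where also
`d / N ≤ √(d / N) ≤ B / 2`; for `N < d` one has `B ≥ 1`, and there is nothing to prove.
-/

open ProbabilityTheory
open scoped NNReal

/-! ### Hoeffding's inequality for residue classes -/

theorem ProbabilityTheory.HasSubgaussianMGF.mono {Ω : Type*} [MeasurableSpace Ω] {μ : Measure Ω} {X : Ω → ℝ}
    {c c' : ℝ≥0} (h : HasSubgaussianMGF X c μ) (hc : c ≤ c') : HasSubgaussianMGF X c' μ where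
  integrable_exp_mul := h.integrable_exp_mul
  mgf_le t := (h.mgf_le t).trans <| by gcongr

/-- The sum of `#s` sub-Gaussian variables of parameter `c`, with no independence assumed. -/
theorem ProbabilityTheory.HasSubgaussianMGF.sum_card_sq {Ω ι : Type*} [MeasurableSpace Ω] {μ : Measure Ω}
    [IsProbabilityMeasure μ] {X : ι → Ω → ℝ} {c : ℝ≥0} (s : Finset ι)
    (h : ∀ i ∈ s, HasSubgaussianMGF (X i) c μ) :
    HasSubgaussianMGF (fun ω => ∑ i ∈ s, X i ω) (s.card ^ 2 * c) μ := by
  classical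
  induction s using Finset.induction_on with
  | empty => simp
  | insert i s his ih =>
    have h1 := (h i (Finset.mem_insert_self _ _)).add
      (ih fun j hj => h j (Finset.mem_insert_of_mem hj))
    simp_rw [Finset.sum_insert his]
    refine HasSubgaussianMGF.mono h1 (le_of_eq ?_)
    rw [Finset.card_insert_of_notMem his, NNReal.sqrt_mul, NNReal.sqrt_sq]
    push_cast
    have h2 : c = NNReal.sqrt c ^ 2 := (NNReal.sq_sqrt c).symm
    generalize NNReal.sqrt c = x at h2 ⊢
    rw [h2]
    ring

/-- Hoeffding's inequality for a sequence of `[0, 1]`-valued variables whose members with indices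
in the same residue class modulo `L` are independent. -/
theorem measure_abs_sum_sub_ge_le_of_residue_indep {Ω : Type*} [MeasurableSpace Ω] {μ : Measure Ω}
    [IsProbabilityMeasure μ] {Y : ℕ → Ω → ℝ} {L N : ℕ} {p ε : ℝ} (hL : 0 < L) (hLN : L ≤ N)
    (hY : ∀ n, Measurable (Y n)) (hb : ∀ n ω, Y n ω ∈ Set.Icc 0 1) (hp : ∀ n, μ[Y n] = p)
    (hind : ∀ r, iIndepFun
      (fun n : {n // n ∈ (Finset.range N).filter (fun n => n % L = r)} => Y n) μ)
    (hε : 0 ≤ ε) :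
    μ.real {ω | ε ≤ |∑ n ∈ Finset.range N, Y n ω - N * p|} ≤
      2 * Real.exp (-ε ^ 2 / (L * N)) := by
  -- Hoeffding's lemma: a variable with values in an interval of length `1` has parameter `1 / 4`.
  have hsub : ∀ n, HasSubgaussianMGF (fun ω => Y n ω - p) (1 / 4) μ := fun n => by
    have := hasSubgaussianMGF_of_mem_Icc (a := 0) (b := 1) (hY n).aemeasurable
      (Filter.Eventually.of_forall (hb n) : ∀ᵐ ω ∂μ, _)
    rw [hp] at this
    refine HasSubgaussianMGF.mono this (le_of_eq ?_)
    simp; norm_num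
  have hclass : ∀ r, HasSubgaussianMGF
      (fun ω => ∑ n ∈ (Finset.range N).filter (fun n => n % L = r), (Y n ω - p))
      ((N / L + 1 : ℕ) * (1 / 4)) μ := fun r => by
    have h1 := HasSubgaussianMGF.sum_of_iIndepFun (c := fun _ => 1 / 4)
      ((hind r).comp (g := fun _ x => x - p) (fun _ => by fun_prop))
      (s := Finset.univ) (fun n _ => hsub n)
    have h2 : (fun ω => ∑ n ∈ (Finset.range N).filter (fun n => n % L = r), (Y n ω - p)) =
        fun ω => ∑ n : {n // n ∈ (Finset.range N).filter (fun n => n % L = r)},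
          (Y n ω - p) := by
      funext ω
      exact (Finset.sum_coe_sort _ (fun n => Y n ω - p)).symm
    rw [h2]
    refine HasSubgaussianMGF.mono h1 ?_
    rw [Finset.sum_const, nsmul_eq_mul, Finset.card_univ, Fintype.card_coe]
    gcongr
    rw [← Finset.card_range (N / L + 1)]
    refine Finset.card_le_card_of_injOn (fun n => n / L) (fun n hn => ?_) fun m hm n hn h => ?_
    · simp only [Finset.coe_filter, Finset.mem_range, Set.mem_ofPred_eq] at hn
      simpa [Nat.lt_succ_iff] using Nat.div_le_div_right hn.1.le
    · simp only [Finset.coe_filter, Finset.mem_range, Set.mem_ofPred_eq] at hm hn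
      rw [← Nat.div_add_mod m L, ← Nat.div_add_mod n L, hm.2, hn.2]
      simp only at h
      rw [h]
  -- The classes need not be independent of each other, so here the standard deviations add up.
  have htot := HasSubgaussianMGF.sum_card_sq (Finset.range L) (fun r _ => hclass r)
  have hfib : ∀ ω, ∑ r ∈ Finset.range L,
      ∑ n ∈ (Finset.range N).filter (fun n => n % L = r), (Y n ω - p) =
        ∑ n ∈ Finset.range N, Y n ω - N * p := fun ω => by
    rw [Finset.sum_fiberwise_of_maps_to
      (fun n _ => Finset.mem_range.mpr (Nat.mod_lt n hL)) (fun n => Y n ω - p)]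
    simp
  simp_rw [hfib] at htot
  have hbound : HasSubgaussianMGF (fun ω => ∑ n ∈ Finset.range N, Y n ω - N * p)
      ((L * N : ℕ) * (1 / 2)) μ := by
    refine HasSubgaussianMGF.mono htot ?_
    rw [Finset.card_range]
    have h3 : L * (N / L + 1) ≤ 2 * N := by
      have := Nat.mul_div_le N L
      lia
    have h4 : ((L : ℝ≥0) * ((N / L + 1 : ℕ) : ℝ≥0)) ≤ 2 * N := by exact_mod_cast h3
    calc (L : ℝ≥0) ^ 2 * (((N / L + 1 : ℕ) : ℝ≥0) * (1 / 4))
        = L * (L * ((N / L + 1 : ℕ) : ℝ≥0)) * (1 / 4) := by ring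
      _ ≤ L * (2 * N) * (1 / 4) := by gcongr
      _ = ((L * N : ℕ) : ℝ≥0) * (1 / 2) := by
        push_cast
        rw [← NNReal.coe_inj]; push_cast; ring
  have hexp : ∀ x : ℝ, -x ^ 2 / (2 * (((L * N : ℕ) : ℝ≥0) * (1 / 2) : ℝ≥0)) =
      -x ^ 2 / (L * N) := fun x => by
    push_cast
    congr 1
    ring
  have hu := hbound.measure_ge_le hε
  have hl := hbound.neg.measure_ge_le hε
  rw [hexp] at hu hl
  have hsubset : {ω | ε ≤ |∑ n ∈ Finset.range N, Y n ω - N * p|} ⊆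
      {ω | ε ≤ ∑ n ∈ Finset.range N, Y n ω - N * p} ∪
        {ω | ε ≤ (-fun ω => ∑ n ∈ Finset.range N, Y n ω - N * p) ω} := fun ω hω => by
    rcases le_abs.mp (show ε ≤ |_| from hω) with h | h
    · exact Or.inl h
    · exact Or.inr h
  calc _ ≤ _ := measureReal_mono hsubset
    _ ≤ _ := measureReal_union_le _ _
    _ ≤ _ := by linarith

/-! ### Haar measure in terms of digits -/

/-- The uniform distribution of a digit. -/
noncomputable def digitMeasure (q : ℕ) [Fact q.Prime] : Measure (ZMod q) := uniformOn Set.univ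

instance (q : ℕ) [Fact q.Prime] : IsProbabilityMeasure (digitMeasure q) := by
  unfold digitMeasure; infer_instance

theorem digitMeasure_singleton {q : ℕ} [Fact q.Prime] (a : ZMod q) :
    digitMeasure q {a} = (q : ENNReal)⁻¹ := by
  rw [digitMeasure, uniformOn_univ, Measure.count_singleton, ZMod.card, one_div]

theorem digitMeasure_map_add {q : ℕ} [Fact q.Prime] (b : ZMod q) :
    (digitMeasure q).map (fun a => b + a) = digitMeasure q := by
  refine Measure.ext_of_singleton fun a => ?_
  rw [Measure.map_apply (by fun_prop) (MeasurableSet.singleton a)]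
  have : (fun a => b + a) ⁻¹' {a} = {-b + a} := by
    ext x; simp [eq_neg_add_iff_add_eq]
  rw [this, digitMeasure_singleton, digitMeasure_singleton]

/-- The element `∑_{i ≥ 1} a_{i-1} t⁻ⁱ` of the group of fractional parts. -/
noncomputable def fracOfDigits {q : ℕ} [Fact q.Prime] (a : ℕ → ZMod q) : FracGroup q :=
  ⟨ofDigits a, by
    have := Set.mem_range_self (f := ofDigits (q := q)) a
    rwa [range_ofDigits] at this⟩

theorem continuous_fracOfDigits (q : ℕ) [Fact q.Prime] : Continuous (fracOfDigits (q := q)) :=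
  (continuous_ofDigits q).subtype_mk _

theorem measurable_fracOfDigits (q : ℕ) [Fact q.Prime] : Measurable (fracOfDigits (q := q)) :=
  (continuous_fracOfDigits q).measurable

theorem exists_fracOfDigits {q : ℕ} [Fact q.Prime] (g : FracGroup q) :
    ∃ a, fracOfDigits a = g := by
  have := g.2
  rw [← SetLike.mem_coe, ← range_ofDigits] at this
  obtain ⟨a, ha⟩ := this
  exact ⟨a, Subtype.ext ha⟩

theorem fracOfDigits_add {q : ℕ} [Fact q.Prime] (a b : ℕ → ZMod q) :
    fracOfDigits (fun i => a i + b i) = fracOfDigits a + fracOfDigits b := by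
  refine Subtype.ext (HahnSeries.ext (funext fun i => ?_))
  change (ofDigits _).coeff i = (ofDigits a + ofDigits b).coeff i
  rw [HahnSeries.coeff_add]
  simp only [coeff_ofDigits]
  split_ifs <;> simp

/-- Normalized Haar measure makes the coefficients independent and uniform: the right-hand side
is translation invariant, and Haar probability measures are unique. -/
theorem normHaar_eq_map (q : ℕ) [Fact q.Prime] :
    normHaar q = (Measure.infinitePi fun _ : ℕ => digitMeasure q).map fracOfDigits := by
  set ν := (Measure.infinitePi fun _ : ℕ => digitMeasure q).map fracOfDigits with hν
  have hm := measurable_fracOfDigits q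
  have : IsProbabilityMeasure ν := Measure.isProbabilityMeasure_map hm.aemeasurable
  have : ν.IsAddLeftInvariant := ⟨fun g => by
    obtain ⟨b, rfl⟩ := exists_fracOfDigits g
    rw [hν, Measure.map_map (measurable_const_add _) hm]
    have h1 : (fun x => fracOfDigits b + x) ∘ fracOfDigits =
        fracOfDigits ∘ fun (a : ℕ → ZMod q) i => b i + a i := by
      funext a
      exact (fracOfDigits_add b a).symm
    rw [h1, ← Measure.map_map hm (by fun_prop), Measure.infinitePi_map_pi _ (by fun_prop)]
    simp_rw [digitMeasure_map_add]⟩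
  have : ν.IsOpenPosMeasure :=
    isOpenPosMeasure_of_addLeftInvariant_of_compact Set.univ isCompact_univ (by simp)
  have : ν.IsAddHaarMeasure := { }
  have : IsProbabilityMeasure (normHaar q) := ⟨by
    have := Measure.addHaarMeasure_self (K₀ := (⊤ : PositiveCompacts (FracGroup q)))
    simpa [normHaar] using this⟩
  have : (normHaar q).IsAddHaarMeasure := by unfold normHaar; infer_instance
  exact Measure.isAddHaarMeasure_eq_of_isProbabilityMeasure _ _

/-- The `j`-th element of the group of fractional parts described by an array of digits. -/
noncomputable def fracOfArray {q : ℕ} [Fact q.Prime] {d : ℕ} (ω : Fin d × ℕ → ZMod q) (j : Fin d) :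
    FracGroup q :=
  fracOfDigits fun i => ω (j, i)

theorem normHaarPi_eq_map (q : ℕ) [Fact q.Prime] (d : ℕ) :
    normHaarPi q d =
      (Measure.infinitePi fun _ : Fin d × ℕ => digitMeasure q).map fracOfArray := by
  have hm := measurable_fracOfDigits q
  have h1 := Measure.infinitePi_map_curry (fun (_ : Fin d) (_ : ℕ) => digitMeasure q)
  have h2 : (fracOfArray : (Fin d × ℕ → ZMod q) → _) =
      (fun (x : Fin d → ℕ → ZMod q) j => fracOfDigits (x j)) ∘
        MeasurableEquiv.curry (Fin d) ℕ (ZMod q) := rfl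
  have : IsProbabilityMeasure
      ((Measure.infinitePi fun _ : ℕ => digitMeasure q).map fracOfDigits) :=
    Measure.isProbabilityMeasure_map hm.aemeasurable
  rw [h2, ← Measure.map_map (by fun_prop) (by fun_prop), h1, Measure.infinitePi_eq_pi,
    Measure.pi_map_pi (fun _ => hm.aemeasurable), normHaarPi, normHaar_eq_map]

/-! ### Digit expansions -/

/-- The integer whose `q`-ary expansion consists of the first `L` digits of `b`. -/
def leadValue {q : ℕ} (b : ℕ → ZMod q) : ℕ → ℕ
  | 0 => 0
  | L + 1 => q * leadValue b L + (b L).val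

theorem leadValue_congr {q : ℕ} {b b' : ℕ → ZMod q} {L : ℕ} (h : ∀ l < L, b l = b' l) :
    leadValue b L = leadValue b' L := by
  induction L with
  | zero => rfl
  | succ L ih => rw [leadValue, leadValue, ih fun l hl => h l (by lia), h L (by lia)]

/-- Each integer below `q ^ L` is the leading value of exactly one string of `L` digits. -/
theorem exists_leadValue_eq_iff {q : ℕ} [Fact q.Prime] {L v : ℕ} (hv : v < q ^ L) :
    ∃ w : ℕ → ZMod q, ∀ b, leadValue b L = v ↔ ∀ l < L, b l = w l := by
  have hq : 0 < q := (Fact.out : q.Prime).pos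
  induction L generalizing v with
  | zero => exact ⟨0, fun b => by simp at hv; simp [leadValue, hv]⟩
  | succ L ih =>
    obtain ⟨w, hw⟩ := ih (v := v / q) (Nat.div_lt_of_lt_mul (by rwa [pow_succ'] at hv))
    refine ⟨Function.update w L (v % q : ℕ), fun b => ?_⟩
    have h1 : leadValue b (L + 1) = v ↔ leadValue b L = v / q ∧ (b L).val = v % q := by
      rw [leadValue]
      have hlt := ZMod.val_lt (b L)
      constructor
      · rintro rfl
        rw [Nat.mul_add_div hq, Nat.mul_add_mod, Nat.div_eq_of_lt hlt, Nat.mod_eq_of_lt hlt]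
        simp
      · rintro ⟨h, h'⟩
        rw [h, h', Nat.div_add_mod]
    have h2 : (b L).val = v % q ↔ b L = (v % q : ℕ) := by
      rw [← (ZMod.val_injective q).eq_iff, ZMod.val_cast_of_lt (Nat.mod_lt v hq)]
    rw [h1, h2, hw, Nat.forall_lt_succ_right]
    simp only [Function.update_self]
    refine and_congr_left fun _ => forall₂_congr fun l hl => ?_
    rw [Function.update_of_ne hl.ne]

/-- The real number `∑ b_i q^{-(i+1)}` with `q`-ary digits `b`. -/
noncomputable def digitSum {q : ℕ} (b : ℕ → ZMod q) : ℝ :=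
  ∑' i : ℕ, ((b i).val : ℝ) * ((q : ℝ)⁻¹) ^ (i + 1)

theorem phi_fracPart_tVar_pow_mul {q : ℕ} [Fact q.Prime] (a : ℕ → ZMod q) (n : ℕ) :
    phi (fracPart (tVar q ^ n * (fracOfDigits a : LaurentInv q))) =
      digitSum fun i => a (n + i) := by
  rw [phi, digitSum]
  congr 1
  funext i
  have h1 : (fracPart (tVar q ^ n * (fracOfDigits a : LaurentInv q))).1.coeff ((i : ℤ) + 1) =
      a (n + i) := by
    change (if 1 ≤ (i : ℤ) + 1 then
      (tVar q ^ n * ofDigits a).coeff ((i : ℤ) + 1) else 0) = _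
    rw [if_pos (by lia), tVar, HahnSeries.single_pow, one_pow]
    have h := HahnSeries.coeff_single_mul_add (r := (1 : ZMod q))
      (x := ofDigits a) (a := (i : ℤ) + 1 + n) (b := n • (-1 : ℤ))
    rw [show (i : ℤ) + 1 + n + n • (-1 : ℤ) = i + 1 by simp, one_mul] at h
    rw [h, coeff_ofDigits, if_pos (by lia)]
    congr 1
    lia
  rw [h1]

/-- The expansion with all digits equal to `q - 1` has the value `1`. -/
theorem hasSum_digit_bound {q : ℕ} [Fact q.Prime] :
    HasSum (fun i : ℕ => ((q : ℝ) - 1) * ((q : ℝ)⁻¹) ^ (i + 1)) 1 := by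
  have hq : 1 < (q : ℝ) := by exact_mod_cast (Fact.out : q.Prime).one_lt
  have h := (hasSum_geometric_of_lt_one (by positivity) (inv_lt_one_of_one_lt₀ hq)).mul_left
    (((q : ℝ) - 1) * (q : ℝ)⁻¹)
  have h1 : ((q : ℝ) - 1) * (q : ℝ)⁻¹ * (1 - (q : ℝ)⁻¹)⁻¹ = 1 := by
    have : (q : ℝ) - 1 ≠ 0 := by linarith
    field_simp
  rw [h1] at h
  convert! h using 2
  ring

theorem digit_term_le {q : ℕ} [Fact q.Prime] (b : ℕ → ZMod q) (i : ℕ) :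
    ((b i).val : ℝ) * ((q : ℝ)⁻¹) ^ (i + 1) ≤ ((q : ℝ) - 1) * ((q : ℝ)⁻¹) ^ (i + 1) := by
  gcongr
  have := ZMod.val_lt (b i)
  rw [le_sub_iff_add_le]
  exact_mod_cast this

theorem summable_digits {q : ℕ} [Fact q.Prime] (b : ℕ → ZMod q) :
    Summable fun i : ℕ => ((b i).val : ℝ) * ((q : ℝ)⁻¹) ^ (i + 1) :=
  Summable.of_nonneg_of_le (fun i => by positivity) (digit_term_le b) hasSum_digit_bound.summable

theorem digitSum_mem_Icc {q : ℕ} [Fact q.Prime] (b : ℕ → ZMod q) :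
    digitSum b ∈ Set.Icc (0 : ℝ) 1 := by
  refine ⟨tsum_nonneg fun i => by positivity, ?_⟩
  rw [← (hasSum_digit_bound (q := q)).tsum_eq]
  exact (summable_digits b).tsum_le_tsum (digit_term_le b) hasSum_digit_bound.summable

theorem digitSum_eq {q : ℕ} [Fact q.Prime] (b : ℕ → ZMod q) (L : ℕ) :
    digitSum b = (leadValue b L + digitSum fun i => b (L + i)) / (q : ℝ) ^ L := by
  have hq : (q : ℝ) ≠ 0 := by exact_mod_cast (Fact.out : q.Prime).ne_zero
  induction L with
  | zero => simp [leadValue]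
  | succ L ih =>
    have h : digitSum (fun i => b (L + i)) =
        ((b L).val + digitSum fun i => b (L + 1 + i)) / q := by
      rw [digitSum, (summable_digits _).tsum_eq_zero_add, digitSum, add_div, ← tsum_div_const]
      congr 1
      · simp [div_eq_mul_inv]
      · congr 1
        funext i
        rw [show L + (i + 1) = L + 1 + i by ring, pow_succ, div_eq_mul_inv, mul_assoc]
    rw [ih, h, leadValue]
    push_cast
    field_simp
    ring

theorem leadValue_div_le_digitSum {q : ℕ} [Fact q.Prime] (b : ℕ → ZMod q) (L : ℕ) :
    (leadValue b L : ℝ) / (q ^ L : ℕ) ≤ digitSum b := by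
  rw [digitSum_eq b L]
  push_cast
  gcongr
  linarith [(digitSum_mem_Icc fun i => b (L + i)).1]

theorem digitSum_le_leadValue_div {q : ℕ} [Fact q.Prime] (b : ℕ → ZMod q) (L : ℕ) :
    digitSum b ≤ ((leadValue b L : ℝ) + 1) / (q ^ L : ℕ) := by
  rw [digitSum_eq b L]
  push_cast
  gcongr
  exact (digitSum_mem_Icc fun i => b (L + i)).2

/-! ### Distribution of the truncated points -/

/-- Disjoint blocks of coordinates of an i.i.d. family are independent. -/
theorem iIndepFun_infinitePi_blocks {ι J K X : Type*} [MeasurableSpace X] (m : Measure X)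
    [IsProbabilityMeasure m] {f : J → K → ι}
    (hf : Function.Injective fun p : J × K => f p.1 p.2) :
    iIndepFun (fun (j : J) (ω : ι → X) (k : K) => ω (f j k)) (Measure.infinitePi fun _ => m) := by
  rw [iIndepFun_iff_map_fun_eq_infinitePi_map (by fun_prop)]
  have h1 : ∀ j : J, (Measure.infinitePi fun _ : ι => m).map (fun ω k => ω (f j k)) =
      Measure.infinitePi fun _ : K => m := fun j =>
    Measure.map_infinitePi_infinitePi_of_inj (P := fun _ : ι => m) (f := f j) fun k k' h =>
      congrArg Prod.snd (@hf (j, k) (j, k') h)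
  have h2 := Measure.map_infinitePi_infinitePi_of_inj (P := fun _ : ι => m) hf
  have h3 := Measure.infinitePi_map_curry (fun (_ : J) (_ : K) => m)
  simp_rw [h1]
  rw [← h3, ← h2, Measure.map_map (by fun_prop) (by fun_prop)]
  rfl

/-- The law of independent uniform digits, in `d` sequences. -/
noncomputable def arrayMeasure (q : ℕ) [Fact q.Prime] (d : ℕ) : Measure (Fin d × ℕ → ZMod q) :=
  Measure.infinitePi fun _ => digitMeasure q

instance (q : ℕ) [Fact q.Prime] (d : ℕ) : IsProbabilityMeasure (arrayMeasure q d) := by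
  unfold arrayMeasure; infer_instance

/-- The event that the `n`-th point of the sequence falls, up to its first `L` digits, into the
box with upper corner `c / q ^ L`. -/
def boxEvent {q d : ℕ} (L : ℕ) (c : Fin d → ℕ) (n : ℕ) : Set (Fin d × ℕ → ZMod q) :=
  {ω | ∀ j, leadValue (fun i => ω (j, n + i)) L < c j}

/-- A box event at time `n` depends on the digits at the indices in `[n, n + L)` only. -/
theorem boxEvent_eq_preimage {q d : ℕ} (L : ℕ) (c : Fin d → ℕ) :
    ∃ S : Set (Fin d × Fin L → ZMod q), ∀ n, boxEvent L c n =
      (fun (ω : Fin d × ℕ → ZMod q) (k : Fin d × Fin L) => ω (k.1, n + k.2)) ⁻¹' S := by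
  refine ⟨{e | ∀ j, leadValue (fun i => if h : i < L then e (j, ⟨i, h⟩) else 0) L < c j},
    fun n => ?_⟩
  ext ω
  refine forall_congr' fun j => ?_
  rw [leadValue_congr]
  intro l hl
  simp [hl]

theorem measurableSet_boxEvent {q d : ℕ} [Fact q.Prime] (L : ℕ) (c : Fin d → ℕ) (n : ℕ) :
    MeasurableSet (boxEvent (q := q) L c n) := by
  obtain ⟨S, hS⟩ := boxEvent_eq_preimage (q := q) L c
  rw [hS]
  exact MeasurableSet.preimage (Set.toFinite S).measurableSet (by fun_prop)

theorem arrayMeasure_boxEvent {q d : ℕ} [Fact q.Prime] {L : ℕ} {c : Fin d → ℕ}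
    (hc : ∀ j, c j ≤ q ^ L) (n : ℕ) :
    (arrayMeasure q d).real (boxEvent L c n) = ∏ j, (c j : ℝ) / (q ^ L : ℕ) := by
  classical
  -- Split the box into grid cells; a cell fixes the `L` leading digits of each coordinate.
  set A : (Fin d → ℕ) → Set (Fin d × ℕ → ZMod q) := fun v =>
    {ω | ∀ j, leadValue (fun i => ω (j, n + i)) L = v j} with hA
  set I := Fintype.piFinset fun j => Finset.range (c j) with hI
  have hunion : boxEvent L c n = ⋃ v ∈ I, A v := by
    ext ω
    simp only [boxEvent, hA, hI, Set.mem_iUnion, Fintype.mem_piFinset, Finset.mem_range,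
      Set.mem_ofPred_eq, exists_prop]
    exact ⟨fun h => ⟨_, h, fun _ => rfl⟩, fun ⟨v, hv, h⟩ j => h j ▸ hv j⟩
  have hcyl : ∀ v ∈ I, ∃ w : Fin d → ℕ → ZMod q, A v =
      Set.pi ((Finset.univ : Finset (Fin d)) ×ˢ Finset.Ico n (n + L) : Finset (Fin d × ℕ))
        (fun k => {w k.1 (k.2 - n)}) := fun v hv => by
    have hv' : ∀ j, v j < q ^ L := fun j =>
      (Finset.mem_range.mp (Fintype.mem_piFinset.mp hv j)).trans_le (hc j)
    choose w hw using fun j => exists_leadValue_eq_iff (hv' j)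
    refine ⟨w, ?_⟩
    ext ω
    simp only [hA, Set.mem_ofPred_eq, hw, Set.mem_pi, Finset.mem_coe, Finset.mem_product,
      Finset.mem_univ, true_and, Finset.mem_Ico, Set.mem_singleton_iff, Prod.forall]
    refine forall_congr' fun j => ⟨fun h i hi => ?_, fun h l hl => ?_⟩
    · have := h (i - n) (by lia)
      rwa [show n + (i - n) = i by lia] at this
    · have := h (n + l) (by lia)
      rwa [show n + l - n = l by lia] at this
  have hmeas : ∀ v ∈ I, MeasurableSet (A v) := fun v hv => by
    obtain ⟨w, hw⟩ := hcyl v hv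
    rw [hw]
    exact MeasurableSet.pi (Finset.countable_toSet _) fun _ _ => MeasurableSet.singleton _
  have hval : ∀ v ∈ I, (arrayMeasure q d).real (A v) = (((q : ℝ) ^ L)⁻¹) ^ d := fun v hv => by
    obtain ⟨w, hw⟩ := hcyl v hv
    rw [hw, Measure.real, arrayMeasure, Measure.infinitePi_pi _ (fun _ _ => MeasurableSet.singleton _)]
    simp only [digitMeasure_singleton, Finset.prod_const, Finset.card_product, Finset.card_univ,
      Fintype.card_fin, Nat.card_Ico, ENNReal.toReal_pow, ENNReal.toReal_inv, ENNReal.toReal_natCast]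
    rw [Nat.add_sub_cancel_left, mul_comm, pow_mul, inv_pow]
  have hdisj : Set.PairwiseDisjoint (I : Set (Fin d → ℕ)) A := fun v _ v' _ hne =>
    Set.disjoint_left.mpr fun ω h h' => hne (funext fun j => (h j).symm.trans (h' j))
  rw [hunion, measureReal_biUnion_finset hdisj hmeas, Finset.sum_congr rfl hval, Finset.sum_const,
    hI, Fintype.card_piFinset]
  simp [div_eq_mul_inv, Finset.prod_mul_distrib]

/-- Concentration of the number of the first `N` points that fall into a box of the grid. -/
theorem arrayMeasure_count_deviation_le {q d : ℕ} [Fact q.Prime] {L N : ℕ} (hL : 0 < L)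
    (hLN : L ≤ N) {c : Fin d → ℕ} (hc : ∀ j, c j ≤ q ^ L) {ε : ℝ} (hε : 0 ≤ ε) :
    (arrayMeasure q d).real {ω | ε ≤ |∑ n ∈ Finset.range N,
        (boxEvent L c n).indicator (fun _ => (1 : ℝ)) ω - N * ∏ j, (c j : ℝ) / (q ^ L : ℕ)|} ≤
      2 * Real.exp (-ε ^ 2 / (L * N)) := by
  have hmeas := measurableSet_boxEvent (q := q) L c
  refine measure_abs_sum_sub_ge_le_of_residue_indep
    (Y := fun n => (boxEvent L c n).indicator fun _ => (1 : ℝ)) hL hLN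
    (fun n => measurable_const.indicator (hmeas n)) (fun n ω => ?_) (fun n => ?_) (fun r => ?_) hε
  · by_cases h : ω ∈ boxEvent L c n <;> simp [h]
  · rw [← arrayMeasure_boxEvent hc n]
    exact integral_indicator_one (hmeas n)
  · obtain ⟨S, hS⟩ := boxEvent_eq_preimage (q := q) L c
    have hinj : Function.Injective
        fun p : {n // n ∈ (Finset.range N).filter (fun n => n % L = r)} × (Fin d × Fin L) =>
          (p.2.1, p.1.1 + (p.2.2 : ℕ)) := by
      rintro ⟨⟨n, hn⟩, j, l⟩ ⟨⟨n', hn'⟩, j', l'⟩ h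
      simp only [Prod.mk.injEq] at h
      simp only [Finset.mem_filter] at hn hn'
      have h1 := Nat.div_add_mod n L
      have h2 := Nat.div_add_mod n' L
      rw [hn.2] at h1
      rw [hn'.2] at h2
      have hl := l.2
      have hl' := l'.2
      -- Both indices lie in one residue class, so blocks of length `L` that meet coincide.
      have h3 : n / L = n' / L := by
        rcases lt_trichotomy (n / L) (n' / L) with hlt | heq | hlt
        · have := Nat.mul_le_mul_left L (Nat.succ_le_of_lt hlt)
          rw [Nat.mul_succ] at this
          lia
        · exact heq
        · have := Nat.mul_le_mul_left L (Nat.succ_le_of_lt hlt)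
          rw [Nat.mul_succ] at this
          lia
      have h4 : n = n' := by rw [← h1, ← h2, h3]
      subst h4
      have h5 : l = l' := Fin.ext (by lia)
      rw [h.1, h5]
    have hblocks := iIndepFun_infinitePi_blocks (digitMeasure q)
      (f := fun (n : {n // n ∈ (Finset.range N).filter (fun n => n % L = r)})
        (k : Fin d × Fin L) => (k.1, n.1 + (k.2 : ℕ))) hinj
    have := hblocks.comp (g := fun _ => S.indicator fun _ => (1 : ℝ))
      (fun _ => Measurable.indicator measurable_const (Set.toFinite S).measurableSet)
    convert! this using 2 with n
    rw [hS]
    rfl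

/-! ### Discretization of the star discrepancy -/

theorem prod_sub_prod_le_sum_sub {ι : Type*} (s : Finset ι) {u v : ι → ℝ} (hv : ∀ i, 0 ≤ v i)
    (hvu : ∀ i, v i ≤ u i) (hu : ∀ i, u i ≤ 1) :
    ∏ i ∈ s, u i - ∏ i ∈ s, v i ≤ ∑ i ∈ s, (u i - v i) := by
  classical
  induction s using Finset.induction_on with
  | empty => simp
  | insert i s his ih =>
    rw [Finset.prod_insert his, Finset.prod_insert his, Finset.sum_insert his]
    have h1 : ∏ i ∈ s, v i ≤ ∏ i ∈ s, u i := Finset.prod_le_prod (fun i _ => hv i) fun i _ => hvu i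
    have h2 : ∏ i ∈ s, v i ≤ 1 := Finset.prod_le_one (fun i _ => hv i) fun i _ => (hvu i).trans (hu i)
    have h3 : 0 ≤ u i := (hv i).trans (hvu i)
    nlinarith [mul_nonneg (sub_nonneg.mpr (hu i)) (sub_nonneg.mpr h1),
      mul_nonneg (sub_nonneg.mpr (hvu i)) (sub_nonneg.mpr h2)]

theorem volume_pi_Ico_zero_toReal {d : ℕ} (t : Set.Icc (0 : Fin d → ℝ) 1) :
    (volume (Set.univ.pi fun j => Set.Ico 0 (t.1 j))).toReal = ∏ j, t.1 j := by
  rw [Real.volume_pi_Ico_toReal (a := fun _ => 0) fun j => t.2.1 j]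
  simp

theorem natCard_subtype_div_le_one {N : ℕ} (p : Fin N → Prop) :
    (Nat.card {n // p n} : ℝ) / N ≤ 1 := by
  refine div_le_one_of_le₀ ?_ (Nat.cast_nonneg N)
  have := Nat.card_le_card_of_injective (Subtype.val : {n // p n} → Fin N) Subtype.val_injective
  rw [Nat.card_fin] at this
  exact_mod_cast this

theorem starDiscrepancy_le_one {d N : ℕ} (P : Fin N → Fin d → ℝ) : starDiscrepancy P ≤ 1 := by
  have : Nonempty (Set.Icc (0 : Fin d → ℝ) 1) := ⟨⟨0, le_rfl, zero_le_one⟩⟩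
  refine ciSup_le fun t => ?_
  rw [volume_pi_Ico_zero_toReal]
  have h1 : ∏ j, t.1 j ≤ 1 := Finset.prod_le_one (fun j _ => t.2.1 j) fun j _ => t.2.2 j
  have h2 : 0 ≤ ∏ j, t.1 j := Finset.prod_nonneg fun j _ => t.2.1 j
  have h3 := natCard_subtype_div_le_one fun n => P n ∈ Set.univ.pi fun j => Set.Ico 0 (t.1 j)
  have h4 : 0 ≤ (Nat.card {n : Fin N // P n ∈ Set.univ.pi fun j => Set.Ico 0 (t.1 j)} : ℝ) / N := by
    positivity
  exact abs_sub_le_iff.mpr ⟨by linarith, by linarith⟩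

/-- The star discrepancy is controlled by the boxes with corners on a grid of mesh `1 / Q`; the
points need to be known only up to the closed grid cell containing them. -/
theorem starDiscrepancy_le_of_grid {d N Q : ℕ} (hQ : 0 < Q) (P : Fin N → Fin d → ℝ)
    (k : Fin N → Fin d → ℕ) (hl : ∀ n j, (k n j : ℝ) / Q ≤ P n j)
    (hu : ∀ n j, P n j ≤ ((k n j : ℝ) + 1) / Q) {η : ℝ}
    (h : ∀ c : Fin d → ℕ, (∀ j, c j ≤ Q) →
      |(Nat.card {n // ∀ j, k n j < c j} : ℝ) / N - ∏ j, (c j : ℝ) / Q| ≤ η) :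
    starDiscrepancy P ≤ η + d / Q := by
  have : Nonempty (Set.Icc (0 : Fin d → ℝ) 1) := ⟨⟨0, le_rfl, zero_le_one⟩⟩
  have hQ' : (0 : ℝ) < Q := by exact_mod_cast hQ
  refine ciSup_le fun t => ?_
  rw [volume_pi_Ico_zero_toReal]
  -- The box lies between the grid boxes with corners `(a - 1) / Q` and `a / Q`.
  set a : Fin d → ℕ := fun j => ⌈t.1 j * Q⌉₊ with ha
  have ht0 : ∀ j, 0 ≤ t.1 j := fun j => t.2.1 j
  have ht1 : ∀ j, t.1 j ≤ 1 := fun j => t.2.2 j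
  have haQ : ∀ j, a j ≤ Q := fun j => Nat.ceil_le.mpr (by nlinarith [ht1 j])
  have hta : ∀ j, t.1 j ≤ (a j : ℝ) / Q := fun j => (le_div_iff₀ hQ').mpr (Nat.le_ceil _)
  -- For `a j = 0` the truncated difference is `0`, and then `t j = 0` as well.
  have hbt : ∀ j, ((a j - 1 : ℕ) : ℝ) / Q ≤ t.1 j := fun j => by
    rw [div_le_iff₀ hQ']
    rcases Nat.eq_zero_or_pos (a j) with h0 | h0
    · rw [h0]
      simpa using mul_nonneg (ht0 j) hQ'.le
    · exact (Nat.lt_ceil.mp (show a j - 1 < a j by lia)).le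
  have hcount_le : Nat.card {n // P n ∈ Set.univ.pi fun j => Set.Ico 0 (t.1 j)} ≤
      Nat.card {n // ∀ j, k n j < a j} := by
    refine Nat.card_le_card_of_injective (Subtype.map id fun n hn j => ?_)
      (Subtype.map_injective _ Function.injective_id)
    refine Nat.lt_ceil.mpr ?_
    exact (div_lt_iff₀ hQ').mp ((hl n j).trans_lt (hn j trivial).2)
  have hle_count : Nat.card {n // ∀ j, k n j < a j - 1} ≤
      Nat.card {n // P n ∈ Set.univ.pi fun j => Set.Ico 0 (t.1 j)} := by
    refine Nat.card_le_card_of_injective (Subtype.map id fun n hn j _ => ⟨?_, ?_⟩)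
      (Subtype.map_injective _ Function.injective_id)
    · exact le_trans (by positivity) (hl n j)
    · have h1 : k n j + 1 < ⌈t.1 j * Q⌉₊ := by have := hn j; lia
      refine (hu n j).trans_lt ((div_lt_iff₀ hQ').mpr ?_)
      exact_mod_cast Nat.lt_ceil.mp h1
  have hup := abs_le.mp (h a haQ)
  have hlo := abs_le.mp (h (fun j => a j - 1) fun j => (Nat.sub_le _ _).trans (haQ j))
  have hprod : ∏ j, (a j : ℝ) / Q - ∏ j, ((a j - 1 : ℕ) : ℝ) / Q ≤ d / Q := by
    refine (prod_sub_prod_le_sum_sub _ (fun j => by positivity) (fun j => ?_) fun j => ?_).trans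
      (le_trans (Finset.sum_le_sum (g := fun _ => 1 / (Q : ℝ)) fun j _ => ?_) ?_)
    · exact (hbt j).trans (hta j)
    · exact div_le_one_of_le₀ (by exact_mod_cast haQ j) hQ'.le
    · rw [← sub_div]
      gcongr
      rw [sub_le_iff_le_add, add_comm]
      exact_mod_cast (by lia : a j ≤ a j - 1 + 1)
    · simp [div_eq_mul_inv]
  have hp1 : ∏ j, t.1 j ≤ ∏ j, (a j : ℝ) / Q :=
    Finset.prod_le_prod (fun j _ => ht0 j) fun j _ => hta j
  have hp2 : ∏ j, ((a j - 1 : ℕ) : ℝ) / Q ≤ ∏ j, t.1 j :=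
    Finset.prod_le_prod (fun j _ => by positivity) fun j _ => hbt j
  have hc1 : (Nat.card {n // P n ∈ Set.univ.pi fun j => Set.Ico 0 (t.1 j)} : ℝ) / N ≤
      (Nat.card {n // ∀ j, k n j < a j} : ℝ) / N := by gcongr
  have hc2 : (Nat.card {n // ∀ j, k n j < a j - 1} : ℝ) / N ≤
      (Nat.card {n // P n ∈ Set.univ.pi fun j => Set.Ico 0 (t.1 j)} : ℝ) / N := by gcongr
  exact abs_sub_le_iff.mpr ⟨by linarith [hup.2], by linarith [hlo.1]⟩

theorem natCard_leadValue_lt_eq_sum {q d N : ℕ} (L : ℕ) (c : Fin d → ℕ)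
    (ω : Fin d × ℕ → ZMod q) :
    (Nat.card {n : Fin N // ∀ j, leadValue (fun i => ω (j, n + i)) L < c j} : ℝ) =
      ∑ n ∈ Finset.range N, (boxEvent L c n).indicator (fun _ => (1 : ℝ)) ω := by
  classical
  rw [Finset.sum_range, Nat.card_eq_fintype_card, Fintype.card_subtype, Finset.card_filter]
  push_cast
  exact Finset.sum_congr rfl fun n _ => by simp [Set.indicator_apply, boxEvent]

/-! ### Union bound over the grid -/

/-- The event that for some box of the grid of mesh `q ^ (-L)` the number of the first `N` points
in it deviates from its mean by at least `ε`. -/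
def deviationEvent (q d L N : ℕ) (ε : ℝ) : Set (Fin d × ℕ → ZMod q) :=
  ⋃ c ∈ Fintype.piFinset fun _ : Fin d => Finset.range (q ^ L + 1),
    {ω | ε ≤ |∑ n ∈ Finset.range N,
        (boxEvent L c n).indicator (fun _ => (1 : ℝ)) ω - N * ∏ j, (c j : ℝ) / (q ^ L : ℕ)|}

theorem arrayMeasure_deviationEvent_le {q d : ℕ} [Fact q.Prime] {L N : ℕ} (hL : 0 < L)
    (hLN : L ≤ N) {ε : ℝ} (hε : 0 ≤ ε) :
    (arrayMeasure q d).real (deviationEvent q d L N ε) ≤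
      ((q : ℝ) ^ L + 1) ^ d * (2 * Real.exp (-ε ^ 2 / (L * N))) := by
  refine (measureReal_biUnion_finset_le _ _).trans ((Finset.sum_le_sum fun c hc =>
    arrayMeasure_count_deviation_le hL hLN (fun j => ?_) hε).trans (le_of_eq ?_))
  · exact Nat.lt_succ_iff.mp (Finset.mem_range.mp (Fintype.mem_piFinset.mp hc j))
  · rw [Finset.sum_const, Fintype.card_piFinset, nsmul_eq_mul]
    simp

/-- Outside the deviation event, the discrepancy is at most the deviation of the grid counts plus the
discretization error. -/
theorem starDiscrepancy_kroneckerPoints_le {q d : ℕ} [Fact q.Prime] {L N : ℕ} (hN : 0 < N)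
    {η : ℝ} {ω : Fin d × ℕ → ZMod q} (hω : ω ∉ deviationEvent q d L N (N * η)) :
    starDiscrepancy (kroneckerPoints (fracOfArray ω) N) ≤ η + d / (q ^ L : ℕ) := by
  have hN' : (0 : ℝ) < N := by exact_mod_cast hN
  have hpt : ∀ (n : Fin N) j, kroneckerPoints (fracOfArray ω) N n j =
      digitSum fun i => ω (j, n + i) := fun n j => phi_fracPart_tVar_pow_mul _ _
  refine starDiscrepancy_le_of_grid (pow_pos (Fact.out : q.Prime).pos L) _
    (fun n j => leadValue (fun i => ω (j, n + i)) L)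
    (fun n j => (hpt n j).symm ▸ leadValue_div_le_digitSum _ L)
    (fun n j => (hpt n j).symm ▸ digitSum_le_leadValue_div _ L) fun c hc => ?_
  simp only [deviationEvent, Set.mem_iUnion, Fintype.mem_piFinset, Finset.mem_range,
    Set.mem_ofPred_eq, not_exists, not_le] at hω
  have h := (hω c fun j => Nat.lt_succ_iff.mpr (hc j)).le
  rw [natCard_leadValue_lt_eq_sum, div_sub' hN'.ne', abs_div, abs_of_pos hN', div_le_iff₀ hN']
  linarith

/-! ### Size of the bound -/

theorem half_le_log_two : 1 / 2 ≤ Real.log 2 := by linarith [Real.log_two_gt_d9]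

/-- The discrepancy bound dominates both the discretization error, if `d ≤ N`, and the trivial bound
`1`, if `N < d`. -/
theorem two_mul_sqrt_le_bound {d N : ℕ} (hd : 2 ≤ d) (hN : 2 ≤ N) {C : ℝ} (hC : 8 ≤ C) :
    2 * √(d / N) ≤ C * Real.log N * √(d * Real.log d / N) := by
  have h2 := half_le_log_two
  have hlN : Real.log 2 ≤ Real.log N := Real.log_le_log (by norm_num) (by exact_mod_cast hN)
  have hld : Real.log 2 ≤ Real.log d := Real.log_le_log (by norm_num) (by exact_mod_cast hd)
  have h1 : 1 / 2 * √(d / N) ≤ √(d * Real.log d / N) := by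
    refine Real.le_sqrt_of_sq_le ?_
    rw [mul_pow, Real.sq_sqrt (by positivity), mul_div_right_comm, mul_comm]
    gcongr
    linarith
  have h3 : 4 ≤ C * Real.log N := by nlinarith
  nlinarith [Real.sqrt_nonneg ((d : ℝ) / N)]

/-- The constant comes from `⌈log_q N⌉ ≤ 1 + log N / log 2 ≤ (2 / log 2) log N`. -/
theorem clog_le_three_mul_log {q N : ℕ} (hq : 2 ≤ q) (hN : 2 ≤ N) :
    (Nat.clog q N : ℝ) ≤ 3 * Real.log N := by
  have h2 := Real.log_two_gt_d9
  have hlN : Real.log 2 ≤ Real.log N := Real.log_le_log (by norm_num) (by exact_mod_cast hN)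
  have h : q ^ (Nat.clog q N).pred < N := Nat.pow_pred_clog_lt_self hq hN
  have hpos := Nat.clog_pos hq hN
  have h3 : (2 : ℝ) ^ (Nat.clog q N).pred ≤ N := by
    exact_mod_cast (Nat.pow_le_pow_left hq _).trans h.le
  have h4 := Real.log_le_log (by positivity) h3
  rw [Real.log_pow] at h4
  have h5 : (Nat.clog q N : ℝ) = ((Nat.clog q N).pred : ℝ) + 1 := by
    exact_mod_cast (Nat.succ_pred_eq_of_pos hpos).symm
  rw [h5]
  nlinarith [(Nat.cast_nonneg (Nat.clog q N).pred : (0 : ℝ) ≤ _)]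

/-- The union bound over the grid costs a factor `(q N) ^ d = exp (d (log q + log N))`, which the
concentration bound absorbs because its exponent is of order `C ^ 2 d log d log N`. -/
theorem grid_card_mul_exp_le {q d N : ℕ} (hq : 2 ≤ q) (hd : 2 ≤ d) (hN : 2 ≤ N) {C : ℝ} {K : ℕ}
    (hC : 24 * (K + 1 + 2 * Real.log q) ≤ C) :
    ((q : ℝ) ^ Nat.clog q N + 1) ^ d *
      (2 * Real.exp (-(N * (C * Real.log N * √(d * Real.log d / N) / 2)) ^ 2 /
        (Nat.clog q N * N))) ≤ 2 * (1 / (N : ℝ) ^ K) := by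
  have hN0 : (0 : ℝ) < N := by positivity
  have hq0 : (0 : ℝ) < q := by positivity
  have h2 := half_le_log_two
  have hlN : Real.log 2 ≤ Real.log N := Real.log_le_log (by norm_num) (by exact_mod_cast hN)
  have hld : Real.log 2 ≤ Real.log d := Real.log_le_log (by norm_num) (by exact_mod_cast hd)
  have hlq : Real.log 2 ≤ Real.log q := Real.log_le_log (by norm_num) (by exact_mod_cast hq)
  have hd1 : (2 : ℝ) ≤ d := by exact_mod_cast hd
  have hL := clog_le_three_mul_log hq hN
  have hLpos := Nat.clog_pos hq hN
  have hL0 : (0 : ℝ) < Nat.clog q N := by exact_mod_cast hLpos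
  have hgrid : (q : ℝ) ^ Nat.clog q N + 1 ≤ q * N := by
    have h : q ^ (Nat.clog q N).pred < N := Nat.pow_pred_clog_lt_self hq hN
    have h' : q ^ Nat.clog q N + 1 ≤ q * N := by
      rw [← Nat.succ_pred_eq_of_pos hLpos, pow_succ']
      have := Nat.mul_le_mul_left q (Nat.succ_le_of_lt h)
      rw [Nat.mul_succ] at this
      lia
    exact_mod_cast h'
  set ℓ := Real.log N with hℓ
  have hℓ0 : 0 < ℓ := by linarith
  have hsq : (N * (C * ℓ * √(d * Real.log d / N) / 2)) ^ 2 =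
      C ^ 2 * ℓ ^ 2 * (d * Real.log d) * N / 4 := by
    have h := Real.sq_sqrt (show 0 ≤ (d : ℝ) * Real.log d / N by
      have := h2.trans hld
      positivity)
    rw [mul_pow, div_pow, mul_pow, mul_pow, h]
    field_simp
    norm_num
  have hC1 : 24 ≤ C := by nlinarith [(Nat.cast_nonneg K : (0 : ℝ) ≤ K)]
  have hexp : d * (K + 1 + 2 * Real.log q) * ℓ ≤
      (N * (C * ℓ * √(d * Real.log d / N) / 2)) ^ 2 / (Nat.clog q N * N) := by
    rw [hsq, le_div_iff₀ (by positivity)]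
    have h3 : 24 * (K + 1 + 2 * Real.log q) ≤ C ^ 2 := by nlinarith
    calc d * (K + 1 + 2 * Real.log q) * ℓ * (Nat.clog q N * N)
        ≤ d * (C ^ 2 / 24) * ℓ * (3 * ℓ * N) := by
          gcongr
          linarith
      _ = C ^ 2 * ℓ ^ 2 * (d * (1 / 2)) * N / 4 := by ring
      _ ≤ _ := by
        gcongr
        exact h2.trans hld
  have hgrid2 : ((q : ℝ) ^ Nat.clog q N + 1) ^ d ≤ Real.exp (d * (Real.log q + ℓ)) := by
    rw [Real.exp_nat_mul, Real.exp_add, Real.exp_log hq0, hℓ, Real.exp_log hN0]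
    gcongr
  have hlast : Real.exp (-(K * ℓ)) = 1 / (N : ℝ) ^ K := by
    rw [Real.exp_neg, Real.exp_nat_mul, hℓ, Real.exp_log hN0, one_div]
  calc _ ≤ Real.exp (d * (Real.log q + ℓ)) *
        (2 * Real.exp (-(d * (K + 1 + 2 * Real.log q) * ℓ))) := by
        rw [neg_div]
        gcongr
    _ = 2 * Real.exp (d * (Real.log q + ℓ) + -(d * (K + 1 + 2 * Real.log q) * ℓ)) := by
        rw [Real.exp_add]
        ring
    _ ≤ 2 * Real.exp (-(K * ℓ)) := by
        gcongr
        have h4 : 0 ≤ (d : ℝ) * (Real.log q * (2 * ℓ - 1)) := by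
          have : 0 ≤ 2 * ℓ - 1 := by linarith
          have : 0 ≤ Real.log q := by linarith
          positivity
        have h5 : 0 ≤ ((d : ℝ) - 1) * (K * ℓ) := by
          have : 0 ≤ (d : ℝ) - 1 := by linarith
          positivity
        nlinarith
    _ = _ := by rw [hlast]

/-! ### The union over all numbers of points -/

/-- Off the deviation events the discrepancy bound holds; for `N < d` the bound is at least `1`. -/
theorem starDiscrepancy_le_of_notMem_deviationEvent {q d N : ℕ} [Fact q.Prime] (hd : 2 ≤ d)
    (hN : 2 ≤ N) {C : ℝ} (hC : 8 ≤ C) {ω : Fin d × ℕ → ZMod q}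
    (hω : d ≤ N → ω ∉ deviationEvent q d (Nat.clog q N) N
      (N * (C * Real.log N * √(d * Real.log d / N) / 2))) :
    starDiscrepancy (kroneckerPoints (fracOfArray ω) N) ≤
      C * Real.log N * √(d * Real.log d / N) := by
  have hN0 : (0 : ℝ) < N := by positivity
  have hB := two_mul_sqrt_le_bound hd hN hC
  rcases le_or_gt d N with hdN | hdN
  · have hx : (d : ℝ) / N ≤ 1 := div_le_one_of_le₀ (by exact_mod_cast hdN) hN0.le
    have h1 : (d : ℝ) / (q ^ Nat.clog q N : ℕ) ≤ d / N := by
      gcongr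
      exact_mod_cast Nat.le_pow_clog (Fact.out : q.Prime).one_lt N
    have h2 : (d : ℝ) / N ≤ √(d / N) :=
      Real.le_sqrt_of_sq_le (by nlinarith [show (0 : ℝ) ≤ d / N by positivity])
    linarith [starDiscrepancy_kroneckerPoints_le (by lia) (hω hdN)]
  · have h1 : 1 ≤ √((d : ℝ) / N) :=
      Real.one_le_sqrt.mpr ((one_le_div₀ hN0).mpr (by exact_mod_cast hdN.le))
    linarith [starDiscrepancy_le_one (kroneckerPoints (fracOfArray ω) N)]

/-- The exponent `k + 2` works for large `k`, as `N⁻ᵏ⁻² ≤ 2⁻ᵏ N⁻²` for `N ≥ 2`. -/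
theorem exists_pow_exponent {δ : ℝ} (hδ : 0 < δ) :
    ∃ K : ℕ, Summable (fun N : ℕ => if 2 ≤ N then 2 * (1 / (N : ℝ) ^ K) else 0) ∧
      ∑' N : ℕ, (if 2 ≤ N then 2 * (1 / (N : ℝ) ^ K) else 0) ≤ δ := by
  have hs : Summable fun N : ℕ => 1 / (N : ℝ) ^ 2 := Real.summable_one_div_nat_pow.mpr (by norm_num)
  set A := ∑' N : ℕ, 1 / (N : ℝ) ^ 2 with hA
  have hA0 : 0 ≤ A := tsum_nonneg fun N => by positivity
  obtain ⟨k, hk⟩ := exists_pow_lt_of_lt_one (show 0 < δ / (2 * (A + 1)) by positivity)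
    (show (1 / 2 : ℝ) < 1 by norm_num)
  have hterm : ∀ N : ℕ, (if 2 ≤ N then 2 * (1 / (N : ℝ) ^ (k + 2)) else 0) ≤
      2 * (1 / 2) ^ k * (1 / (N : ℝ) ^ 2) := fun N => by
    split_ifs with hN
    · rw [pow_add, one_div_pow, mul_assoc, one_div_mul_one_div]
      have : (2 : ℝ) ≤ N := by exact_mod_cast hN
      gcongr
    · positivity
  have hs' := hs.mul_left (2 * (1 / 2 : ℝ) ^ k)
  have hsum : Summable fun N : ℕ => if 2 ≤ N then 2 * (1 / (N : ℝ) ^ (k + 2)) else 0 :=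
    Summable.of_nonneg_of_le (fun N => by split_ifs <;> positivity) hterm hs'
  refine ⟨k + 2, hsum, (hsum.tsum_le_tsum hterm hs').trans ?_⟩
  rw [tsum_mul_left, ← hA]
  rw [lt_div_iff₀ (by positivity)] at hk
  nlinarith [show (0 : ℝ) < (1 / 2) ^ k by positivity]

theorem corollary2 (q : ℕ) [Fact q.Prime] (δ : ℝ) (hδ0 : 0 < δ) (hδ1 : δ < 1) :
    ∃ C : ℝ, 0 < C ∧ ∀ d : ℕ, 2 ≤ d →
      ENNReal.ofReal (1 - δ) ≤
        normHaarPi q d {f : Fin d → FracGroup q | ∀ N : ℕ, 2 ≤ N →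
          starDiscrepancy (kroneckerPoints f N) ≤
            C * Real.log N * Real.sqrt (d * Real.log d / N)} := by
  have hq : 2 ≤ q := (Fact.out : q.Prime).two_le
  obtain ⟨K, hsum, hK⟩ := exists_pow_exponent hδ0
  set C : ℝ := 24 * (K + 1 + 2 * Real.log q) with hC
  have hlq : 0 ≤ Real.log q := Real.log_nonneg (by exact_mod_cast hq.trans' one_le_two)
  have hC8 : 8 ≤ C := by
    have := (Nat.cast_nonneg K : (0 : ℝ) ≤ K)
    linarith
  refine ⟨C, by linarith, fun d hd => ?_⟩
  set B : ℕ → Set (Fin d × ℕ → ZMod q) := fun N => {ω | 2 ≤ N ∧ d ≤ N ∧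
    ω ∈ deviationEvent q d (Nat.clog q N) N
      (N * (C * Real.log N * √(d * Real.log d / N) / 2))} with hB
  have hBle : ∀ N, arrayMeasure q d (B N) ≤
      ENNReal.ofReal (if 2 ≤ N then 2 * (1 / (N : ℝ) ^ K) else 0) := fun N => by
    by_cases hN : 2 ≤ N
    · rw [if_pos hN]
      refine (measure_mono fun ω hω => hω.2.2).trans
        ((ENNReal.le_ofReal_iff_toReal_le (measure_ne_top _ _) (by positivity)).mpr ?_)
      have hε : 0 ≤ N * (C * Real.log N * √(d * Real.log d / N) / 2) := by
        have : 0 ≤ Real.log N := Real.log_natCast_nonneg N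
        positivity
      have hLN : Nat.clog q N ≤ N :=
        Nat.clog_le_of_le_pow (Nat.lt_pow_self (by lia : 1 < q)).le
      exact (arrayMeasure_deviationEvent_le (Nat.clog_pos hq hN) hLN hε).trans
        (grid_card_mul_exp_le hq hd hN hC.ge)
    · rw [show B N = ∅ from Set.eq_empty_of_forall_notMem fun ω hω => hN hω.1, measure_empty]
      exact zero_le
  have hbad : arrayMeasure q d (⋃ N, B N) ≤ ENNReal.ofReal δ :=
    calc _ ≤ ∑' N, arrayMeasure q d (B N) := measure_iUnion_le _
      _ ≤ ∑' N : ℕ, ENNReal.ofReal (if 2 ≤ N then 2 * (1 / (N : ℝ) ^ K) else 0) :=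
        ENNReal.tsum_le_tsum hBle
      _ = ENNReal.ofReal (∑' N : ℕ, if 2 ≤ N then 2 * (1 / (N : ℝ) ^ K) else 0) :=
        (ENNReal.ofReal_tsum_of_nonneg (fun N => by split_ifs <;> positivity) hsum).symm
      _ ≤ _ := ENNReal.ofReal_le_ofReal hK
  have hm : Measurable (fracOfArray : (Fin d × ℕ → ZMod q) → Fin d → FracGroup q) :=
    measurable_pi_lambda _ fun j => (measurable_fracOfDigits q).comp (by fun_prop)
  -- `le_map_apply` needs no measurability of the set of good points.
  rw [normHaarPi_eq_map]
  refine le_trans ?_ (Measure.le_map_apply hm.aemeasurable _)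
  change _ ≤ arrayMeasure q d _
  have hcover : Set.univ ⊆ (⋃ N, B N) ∪ fracOfArray ⁻¹' {f : Fin d → FracGroup q | ∀ N : ℕ, 2 ≤ N →
      starDiscrepancy (kroneckerPoints f N) ≤
        C * Real.log N * Real.sqrt (d * Real.log d / N)} := fun ω _ => by
    by_cases h : ω ∈ ⋃ N, B N
    · exact Or.inl h
    · refine Or.inr fun N hN => starDiscrepancy_le_of_notMem_deviationEvent hd hN hC8
        fun hdN hω => h (Set.mem_iUnion.mpr ⟨N, hN, hdN, hω⟩)
  have htotal := (measure_mono (μ := arrayMeasure q d) hcover).trans (measure_union_le _ _)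
  rw [measure_univ] at htotal
  rw [ENNReal.ofReal_sub _ hδ0.le, ENNReal.ofReal_one, tsub_le_iff_left]
  exact htotal.trans (by gcongr)
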